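/- Let $d\ge 0$, let $\mathbb{R}^{d,1}$ be $\mathbb{R}^{d}\times\mathbb{R}$ with the bilinear form $\langle x,y\rangle_{d,1}=x_1y_1+\dots+x_dy_d-x_{d+1}y_{d+1}$, and write $v=(\bar v,v_{d+1})$ for $v\in\mathbb{R}^{d,1}$. Let $O_+(d,1)$ be the group of linear isometries of $\mathbb{R}^{d,1}$ preserving $\mathcal{H}^d=\{x : \langle x,x\rangle_{d,1}=-1,\ x_{d+1}>0\}$, and let $\Gamma\subset O_+(d,1)$ be a subgroup such that $\mathcal{H}^d/\Gamma$ is a compact hyperbolic manifold (i.e. $\Gamma$ acts freely and properly discontinuously on $\mathcal{H}^d$ with compact quotient). Let $Z^1(\Gamma,\mathbb{R}^{d,1})$ be the space of cocycles, i.e. of maps $\tau:\Gamma\to\mathbb{R}^{d,1}$ with $\tau(AB)=\tau(A)+A(\tau(B))$ for all $A,B\in\Gamma$, with the topology of pointwise convergence. Let $B^d$ be the open Euclidean unit ball of $\mathbb{R}^d$ and $L(x)=\sqrt{1-\|x\|^2}$. The group $O_+(d,1)$ acts on $B^d$ by letting $A\cdot x$ be the point for which $\binom{A\cdot x}{1}$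 is proportional to $A\binom{x}{1}$. A continuous function $h:B^d\to\mathbb{R}$ is called $\tau$-equivariant if for all $A\in\Gamma$ and $x\in B^d$ $$\frac{L(x)}{L(A^{-1}\cdot x)}\,h(A^{-1}\cdot x)+\langle x,\overline{\tau(A)}\rangle_d-\tau(A)_{d+1}=h(x).$$ Then for every cocycle $\tau\in Z^1(\Gamma,\mathbb{R}^{d,1})$ there exists a $C^\infty$ convex $\tau$-equivariant function $h(\tau):B^d\to\mathbb{R}$. Moreover, the functions $h(\tau)$ can be chosen, simultaneously for all $\tau$, so that whenever $\tau_n\to\tau$ in $Z^1(\Gamma,\mathbb{R}^{d,1})$, the functions $h(\tau_n)$ converge to $h(\tau)$ and the second partial derivatives of $h(\tau_n)$ converge to those of $h(\tau)$, uniformly on compact subsets of $B^d$. The same holds with "concave" in place of "convex". -/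

import Mathlib

open Set Filter Topology
open scoped ContDiff

namespace CoMinkowski

noncomputable section

/-- Euclidean space `ℝ^d`. -/
abbrev E (d : ℕ) : Type := EuclideanSpace ℝ (Fin d)

/-- The vector space underlying Minkowski space `ℝ^{d,1}`; a vector is written
`(x.1, x.2)` with horizontal component `x.1 ∈ ℝ^d` and vertical component `x.2 ∈ ℝ`. -/
abbrev V (d : ℕ) : Type := E d × ℝ

/-- The Minkowski bilinear form `x₁y₁ + ⋯ + x_d y_d - x_{d+1} y_{d+1}`. -/
def mink {d : ℕ} (x y : V d) : ℝ := inner ℝ x.1 y.1 - x.2 * y.2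

/-- The hyperboloid model `ℋ^d` of hyperbolic space. -/
def hyperboloid (d : ℕ) : Set (V d) := {x | mink x x = -1 ∧ 0 < x.2}

/-- The group `O_+(d,1)` of linear isometries of Minkowski space preserving `ℋ^d`. -/
def OPlus (d : ℕ) : Subgroup (V d ≃ₗ[ℝ] V d) where
  carrier := {A | (∀ x y, mink (A x) (A y) = mink x y) ∧ A '' hyperboloid d = hyperboloid d}
  one_mem' := ⟨fun _ _ => rfl, by simp⟩
  mul_mem' := by
    rintro A B ⟨hA, hA'⟩ ⟨hB, hB'⟩
    refine ⟨fun x y => ?_, ?_⟩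
    · rw [LinearEquiv.mul_apply, LinearEquiv.mul_apply, hA, hB]
    · have h : (⇑(A * B) : V d → V d) = A ∘ B := rfl
      rw [h, Set.image_comp, hB', hA']
  inv_mem' := by
    rintro A ⟨hA, hA'⟩
    refine ⟨fun x y => ?_, ?_⟩
    · rw [← hA (A⁻¹ x) (A⁻¹ y)]
      exact congrArg₂ mink (A.apply_symm_apply x) (A.apply_symm_apply y)
    · have h : (⇑A⁻¹ : V d → V d) ∘ A = id := funext fun x => A.symm_apply_apply x
      conv_lhs => rw [← hA']
      rw [← Set.image_comp, h, Set.image_id]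

/-- The action of `O_+(d,1)` on the hyperboloid. -/
instance (d : ℕ) : MulAction (OPlus d) (hyperboloid d) where
  smul A p := ⟨A.1 p.1, A.2.2.subset (Set.mem_image_of_mem A.1 p.2)⟩
  one_smul _ := rfl
  mul_smul _ _ _ := rfl

/-- `ℋ^d / Γ` is a compact hyperbolic manifold: `Γ` acts freely and properly discontinuously
on `ℋ^d`, with compact quotient. -/
structure IsCompactHyperbolicManifold {d : ℕ} (Γ : Subgroup (OPlus d)) : Prop where
  free : ∀ (A : Γ) (p : hyperboloid d), A • p = p → A = 1
  properlyDiscontinuous : ProperlyDiscontinuousSMul Γ (hyperboloid d)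
  compact_quotient : CompactSpace (MulAction.orbitRel.Quotient Γ (hyperboloid d))

/-- The space `Z¹(Γ, ℝ^{d,1})` of cocycles. Its topology is that of pointwise convergence. -/
def Z1 {d : ℕ} (Γ : Subgroup (OPlus d)) : Submodule ℝ (Γ → V d) where
  carrier := {τ | ∀ A B : Γ, τ (A * B) = τ A + A.1.1 (τ B)}
  zero_mem' := fun A B => by simp
  add_mem' := by
    intro σ τ hσ hτ A B
    simp only [Pi.add_apply, hσ A B, hτ A B, map_add]
    abel
  smul_mem' := by
    intro c τ hτ A B
    simp only [Pi.smul_apply, hτ A B, map_smul, smul_add]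

/-- The open unit ball `B^d`. -/
def B (d : ℕ) : Set (E d) := Metric.ball 0 1

/-- `L(x) = √(1 - ‖x‖²)`. -/
def L {d : ℕ} (x : E d) : ℝ := Real.sqrt (1 - ‖x‖ ^ 2)

/-- The action `A · x` of `A ∈ O_+(d,1)` on the Klein ball model: `A (x, 1)` is a positive
multiple of `(A · x, 1)`. -/
def klein {d : ℕ} (A : OPlus d) (x : E d) : E d := (A.1 (x, 1)).2⁻¹ • (A.1 (x, 1)).1

/-- The function `(A, v) h` on `B^d` whose graph is the image of the graph of `h` under the
isometry `(A, v)` of co-Minkowski space `B^d × ℝ`. -/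
def act {d : ℕ} (A : OPlus d) (v : V d) (h : E d → ℝ) (x : E d) : ℝ :=
  L x / L (klein A⁻¹ x) * h (klein A⁻¹ x) + inner ℝ x v.1 - v.2

/-- `h : B^d → ℝ` is `τ`-equivariant: it is continuous and `(A, τ(A)) h = h` for all `A ∈ Γ`.
Only the values of `h` on `B^d` matter. -/
def IsEquivariant {d : ℕ} {Γ : Subgroup (OPlus d)} (τ : Z1 Γ) (h : E d → ℝ) : Prop :=
  ContinuousOn h (B d) ∧ ∀ A : Γ, ∀ x ∈ B d, act A.1 (τ.1 A) h x = h x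

/-- Convergence on `B^d`, uniform on compact subsets, of the functions `f n` to `g` and of
their second partial derivatives to those of `g`. -/
def ConvergesWithSecondDerivs {d : ℕ} (f : ℕ → E d → ℝ) (g : E d → ℝ) : Prop :=
  TendstoLocallyUniformlyOn f g atTop (B d) ∧
    TendstoLocallyUniformlyOn (fun n => iteratedFDeriv ℝ 2 (f n)) (iteratedFDeriv ℝ 2 g)
      atTop (B d)

end

end CoMinkowski

/-!
Averaging the affine functions `x ↦ ⟨(x, 1), τ A⟩` against a smooth partition of unity formed by the
`Γ`-translates of one function gives a smooth `τ`-equivariant function `f τ`, depending continuously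
on `τ` together with all its derivatives. It need not be convex. But `L` is `Γ`-invariant with
Hessian at most `-‖w‖²`, so `f τ - c • L` is again equivariant, and for `c` larger than the Hessian
of `f τ` on a compact ball meeting every orbit, its Hessian is nonnegative on that ball. The sign of
the Hessian propagates along orbits: equivariance says that an element of `Γ` changes the
homogeneous extension of degree `1` to the future cone by a linear function only, and the Hessian of
that extension is, up to a positive factor, a pullback of the Hessian on the ball.
-/

namespace CoMinkowski

section Hessian

variable {X : Type*} [NormedAddCommGroup X] [NormedSpace ℝ X]

/-- The Hessian of `f` at `x`, as a quadratic form in `w`. -/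
noncomputable def hessian (f : X → ℝ) (x w : X) : ℝ := iteratedFDeriv ℝ 2 f x fun _ => w

theorem hessian_eq_fderiv_fderiv (f : X → ℝ) (x w : X) :
    hessian f x w = fderiv ℝ (fderiv ℝ f) x w w :=
  iteratedFDeriv_two_apply f x fun _ => w

theorem hessian_sub_const_mul {f g : X → ℝ} {x : X} (hf : ContDiffAt ℝ 2 f x)
    (hg : ContDiffAt ℝ 2 g x) (c : ℝ) (w : X) :
    hessian (fun y => f y - c * g y) x w = hessian f x w - c * hessian g x w := by
  have hcg : ContDiffAt ℝ 2 (fun y => c • g y) x := hg.const_smul c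
  simp only [hessian, ← smul_eq_mul]
  rw [fun_iteratedFDeriv_sub_apply hf hcg, iteratedFDeriv_const_smul_apply' hg]
  rfl

theorem hasDerivAt_add_smul (x w : X) (t : ℝ) : HasDerivAt (fun s : ℝ => x + s • w) w t := by
  simpa using ((hasDerivAt_id t).smul_const w).const_add x

theorem hasDerivAt_fderiv_add_smul {f : X → ℝ} {x w : X} {t : ℝ}
    (hf : ContDiffAt ℝ 2 f (x + t • w)) :
    HasDerivAt (fun s : ℝ => fderiv ℝ f (x + s • w) w) (hessian f (x + t • w) w) t := by
  have hf' : DifferentiableAt ℝ (fderiv ℝ f) (x + t • w) :=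
    (hf.fderiv_right (m := 1) (by norm_num)).differentiableAt one_ne_zero
  have hgrad : HasDerivAt (fun s : ℝ => fderiv ℝ f (x + s • w))
      (fderiv ℝ (fderiv ℝ f) (x + t • w) w) t :=
    hf'.hasFDerivAt.comp_hasDerivAt t (hasDerivAt_add_smul x w t)
  simpa [hessian_eq_fderiv_fderiv] using hgrad.clm_apply (hasDerivAt_const t w)

theorem hessian_eq_of_hasFDerivAt {f : X → ℝ} {f' : X → X →L[ℝ] ℝ} {x w : X} {c : ℝ}
    (hf : ContDiffAt ℝ 2 f x) (hf' : ∀ᶠ y in 𝓝 x, HasFDerivAt f (f' y) y)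
    (hc : HasDerivAt (fun t : ℝ => f' (x + t • w) w) c 0) : hessian f x w = c := by
  have hx : x + (0 : ℝ) • w = x := by simp
  have hline : Tendsto (fun t : ℝ => x + t • w) (𝓝 0) (𝓝 x) := by
    simpa only [hx] using (hasDerivAt_add_smul x w 0).continuousAt.tendsto
  have hd := hasDerivAt_fderiv_add_smul (w := w) (t := 0) (hx.symm ▸ hf)
  rw [hx] at hd
  refine hd.unique (hc.congr_of_eventuallyEq ?_)
  filter_upwards [hline.eventually hf'] with t ht using by rw [ht.fderiv]

theorem hessian_eq_of_eventuallyEq_comp_add {Y : Type*} [NormedAddCommGroup Y] [NormedSpace ℝ Y]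
    {f : X → ℝ} {g : Y → ℝ} (M : X →L[ℝ] Y) (ℓ : X →L[ℝ] ℝ) {x : X}
    (hg : ContDiffAt ℝ 2 g (M x)) (hfg : f =ᶠ[𝓝 x] fun y => g (M y) + ℓ y) (w : X) :
    hessian f x w = hessian g (M x) (M w) := by
  have hgM : ContDiffAt ℝ 2 (fun y => g (M y) + ℓ y) x :=
    (hg.comp x M.contDiff.contDiffAt).add ℓ.contDiff.contDiffAt
  refine hessian_eq_of_hasFDerivAt (f' := fun y => (fderiv ℝ g (M y)).comp M + ℓ)
    (hgM.congr_of_eventuallyEq hfg) ?_ ?_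
  · have hdiff : ∀ᶠ y in 𝓝 x, ContDiffAt ℝ 2 g (M y) :=
      M.continuous.continuousAt.eventually (hg.eventually (by simp))
    filter_upwards [hdiff, hfg.eventuallyEq_nhds] with y hy hfgy
    exact (((hy.differentiableAt two_ne_zero).hasFDerivAt.comp y M.hasFDerivAt).add
      ℓ.hasFDerivAt).congr_of_eventuallyEq hfgy
  · have hline : M x + (0 : ℝ) • M w = M x := by simp
    have hd := (hasDerivAt_fderiv_add_smul (w := M w) (t := 0) (hline.symm ▸ hg)).add_const (ℓ w)
    rw [hline] at hd
    simpa using hd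

theorem convexOn_of_hessian_nonneg {f : X → ℝ} {s : Set X} (hs : IsOpen s) (hsc : Convex ℝ s)
    (hf : ContDiffOn ℝ 2 f s) (hpos : ∀ x ∈ s, ∀ w, 0 ≤ hessian f x w) : ConvexOn ℝ s f := by
  refine ⟨hsc, fun x hx y hy a b ha hb hab => ?_⟩
  have hmem : ∀ t ∈ Icc (0 : ℝ) 1, x + t • (y - x) ∈ s := fun t ht =>
    hsc.add_smul_sub_mem hx hy ht
  have hsmooth : ∀ t ∈ Icc (0 : ℝ) 1, ContDiffAt ℝ 2 f (x + t • (y - x)) := fun t ht =>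
    hf.contDiffAt (hs.mem_nhds (hmem t ht))
  have hderiv : ∀ t ∈ Icc (0 : ℝ) 1, HasDerivAt (fun t : ℝ => f (x + t • (y - x)))
      (fderiv ℝ f (x + t • (y - x)) (y - x)) t := fun t ht =>
    ((hsmooth t ht).differentiableAt two_ne_zero).hasFDerivAt.comp_hasDerivAt t
      (hasDerivAt_add_smul x (y - x) t)
  have hconv : ConvexOn ℝ (Icc (0 : ℝ) 1) fun t => f (x + t • (y - x)) :=
    convexOn_of_hasDerivWithinAt2_nonneg (convex_Icc 0 1)
      (fun t ht => (hderiv t ht).continuousAt.continuousWithinAt)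
      (fun t ht => (hderiv t (interior_subset ht)).hasDerivWithinAt)
      (fun t ht =>
        (hasDerivAt_fderiv_add_smul (hsmooth t (interior_subset ht))).hasDerivWithinAt)
      fun t ht => hpos _ (hmem t (interior_subset ht)) _
  have hcomb : x + b • (y - x) = a • x + b • y := by
    rw [eq_sub_of_add_eq hab]
    module
  simpa [hcomb] using
    hconv.2 (left_mem_Icc.2 zero_le_one) (right_mem_Icc.2 zero_le_one) ha hb hab

end Hessian

section Perspective

variable {X : Type*} [NormedAddCommGroup X] [NormedSpace ℝ X]

/-- The central projection `(v, c) ↦ v / c` to the affine hyperplane at height `1`. On vectors of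
height `0` it takes the junk value `0`. -/
noncomputable def proj (p : X × ℝ) : X := p.2⁻¹ • p.1

/-- The perspective of `h`: its extension to a function homogeneous of degree `1` on the vectors of
nonzero height, where `h` lives on the affine hyperplane at height `1`. -/
noncomputable def perspective (h : X → ℝ) (p : X × ℝ) : ℝ := p.2 * h (proj p)

theorem proj_smul {c : ℝ} (hc : c ≠ 0) (p : X × ℝ) : proj (c • p) = proj p := by
  simp only [proj, Prod.smul_fst, Prod.smul_snd, smul_eq_mul, mul_inv, smul_smul]
  rw [mul_right_comm, inv_mul_cancel₀ hc, one_mul]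

theorem proj_prodMk_one (x : X) : proj (x, (1 : ℝ)) = x := by simp [proj]

theorem smul_proj {p : X × ℝ} (hp : p.2 ≠ 0) : p.2 • (proj p, (1 : ℝ)) = p := by
  ext1 <;> simp [proj, hp]

theorem perspective_smul (h : X → ℝ) {c : ℝ} (hc : c ≠ 0) (p : X × ℝ) :
    perspective h (c • p) = c * perspective h p := by
  rw [perspective, proj_smul hc, Prod.smul_snd, smul_eq_mul, mul_assoc, perspective]

theorem perspective_prodMk_one (h : X → ℝ) (x : X) : perspective h (x, 1) = h x := by
  rw [perspective, proj_prodMk_one, one_mul]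

theorem perspective_sub_const_mul (f g : X → ℝ) (c : ℝ) (p : X × ℝ) :
    perspective (fun x => f x - c * g x) p = perspective f p - c * perspective g p := by
  simp only [perspective]
  ring

theorem contDiffAt_proj {n : WithTop ℕ∞} {p : X × ℝ} (hp : p.2 ≠ 0) :
    ContDiffAt ℝ n (proj (X := X)) p :=
  (contDiffAt_snd.inv hp).smul contDiffAt_fst

theorem contDiffAt_perspective {n : WithTop ℕ∞} {h : X → ℝ} {p : X × ℝ} (hp : p.2 ≠ 0)
    (hh : ContDiffAt ℝ n h (proj p)) : ContDiffAt ℝ n (perspective h) p :=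
  contDiffAt_snd.mul (hh.comp p (contDiffAt_proj hp))

theorem hasFDerivAt_proj {p : X × ℝ} (hp : p.2 ≠ 0) :
    HasFDerivAt proj (p.2⁻¹ • (ContinuousLinearMap.fst ℝ X ℝ
      - (ContinuousLinearMap.snd ℝ X ℝ).smulRight (proj p))) p := by
  have hinv : HasFDerivAt (fun q : X × ℝ => q.2⁻¹)
      (-(p.2 ^ 2)⁻¹ • ContinuousLinearMap.snd ℝ X ℝ) p :=
    (hasDerivAt_inv hp).comp_hasFDerivAt p hasFDerivAt_snd
  refine (hinv.smul hasFDerivAt_fst).congr_fderiv ?_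
  ext1 <;> ext <;> simp [proj, smul_smul, pow_two]

theorem hasFDerivAt_perspective {h : X → ℝ} {p : X × ℝ} (hp : p.2 ≠ 0)
    (hh : DifferentiableAt ℝ h (proj p)) :
    HasFDerivAt (perspective h) (h (proj p) • ContinuousLinearMap.snd ℝ X ℝ
      + (fderiv ℝ h (proj p)).comp (ContinuousLinearMap.fst ℝ X ℝ
        - (ContinuousLinearMap.snd ℝ X ℝ).smulRight (proj p))) p := by
  refine (hasFDerivAt_snd.mul (hh.hasFDerivAt.comp p (hasFDerivAt_proj hp))).congr_fderiv ?_
  rw [ContinuousLinearMap.comp_smul, smul_inv_smul₀ hp, add_comm, Function.comp_apply]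

theorem hessian_perspective {h : X → ℝ} {p : X × ℝ} (hp : p.2 ≠ 0)
    (hh : ContDiffAt ℝ 2 h (proj p)) (u : X × ℝ) :
    hessian (perspective h) p u = p.2⁻¹ * hessian h (proj p) (u.1 - u.2 • proj p) := by
  set w := u.1 - u.2 • proj p with hw
  have hline : p + (0 : ℝ) • u = p := by simp
  have hproj : HasDerivAt (fun t : ℝ => proj (p + t • u)) (p.2⁻¹ • w) 0 :=
    (HasFDerivAt.comp_hasDerivAt_of_eq 0 (hasFDerivAt_proj hp) (hasDerivAt_add_smul p u 0)
      hline.symm).congr_deriv (by simp [hw])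
  have hval : HasDerivAt (fun t : ℝ => h (proj (p + t • u)))
      (fderiv ℝ h (proj p) (p.2⁻¹ • w)) 0 :=
    HasFDerivAt.comp_hasDerivAt_of_eq 0 (hh.differentiableAt two_ne_zero).hasFDerivAt hproj
      (by simp)
  have hgrad : HasDerivAt (fun t : ℝ => fderiv ℝ h (proj (p + t • u)))
      (fderiv ℝ (fderiv ℝ h) (proj p) (p.2⁻¹ • w)) 0 :=
    HasFDerivAt.comp_hasDerivAt_of_eq 0
      ((hh.fderiv_right (m := 1) (by norm_num)).differentiableAt one_ne_zero).hasFDerivAt hproj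
      (by simp)
  have hdir : HasDerivAt (fun t : ℝ => u.1 - u.2 • proj (p + t • u))
      (-(u.2 • p.2⁻¹ • w)) 0 :=
    (hproj.const_smul u.2).const_sub u.1
  have hderiv := (hval.mul_const u.2).add (hgrad.clm_apply hdir)
  refine hessian_eq_of_hasFDerivAt (f' := fun q => h (proj q) • ContinuousLinearMap.snd ℝ X ℝ
    + (fderiv ℝ h (proj q)).comp (ContinuousLinearMap.fst ℝ X ℝ
      - (ContinuousLinearMap.snd ℝ X ℝ).smulRight (proj q)))
    (contDiffAt_perspective hp hh) ?_ (hderiv.congr_deriv ?_)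
  · have hne : ∀ᶠ q : X × ℝ in 𝓝 p, q.2 ≠ 0 := continuous_snd.continuousAt.eventually_ne hp
    have hdiff : ∀ᶠ q in 𝓝 p, ContDiffAt ℝ 2 h (proj q) :=
      (contDiffAt_proj (n := 0) hp).continuousAt.eventually (hh.eventually (by simp))
    filter_upwards [hne, hdiff] with q hq hhq
    exact hasFDerivAt_perspective hq (hhq.differentiableAt two_ne_zero)
  · rw [hline, ← hw, hessian_eq_fderiv_fderiv]
    simp only [map_smul, smul_eq_mul, smul_apply, map_neg]
    ring

end Perspective

section SmoothFamily

theorem tendstoLocallyUniformlyOn_of_continuousOn {ι T X Y : Type*} [TopologicalSpace T]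
    [TopologicalSpace X] [UniformSpace Y] {F : T → X → Y} {s : Set X}
    (hF : ContinuousOn (fun p : T × X => F p.1 p.2) (univ ×ˢ s)) {l : Filter ι} {u : ι → T} {t : T}
    (hu : Tendsto u l (𝓝 t)) : TendstoLocallyUniformlyOn (fun i => F (u i)) (F t) l s := by
  rw [tendstoLocallyUniformlyOn_iff_forall_tendsto]
  intro x hx
  have hFx : Tendsto (fun p : T × X => F p.1 p.2) (𝓝 t ×ˢ 𝓝[s] x) (𝓝 (F t x)) := by
    simpa only [ContinuousWithinAt, nhdsWithin_prod_eq, nhdsWithin_univ] using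
      hF (t, x) ⟨mem_univ t, hx⟩
  have hlim : Tendsto (fun p : ι × X => F t p.2) (l ×ˢ 𝓝[s] x) (𝓝 (F t x)) :=
    hFx.comp (tendsto_const_nhds.prodMk tendsto_snd)
  exact (hlim.prodMk_nhds (hFx.comp (hu.prodMap tendsto_id))).mono_right (nhds_le_uniformity _)

variable {ι T X Y Z : Type*} [TopologicalSpace T] [NormedAddCommGroup X] [NormedSpace ℝ X]
  [NormedAddCommGroup Y] [NormedSpace ℝ Y] [NormedAddCommGroup Z] [NormedSpace ℝ Z]

/-- A family of functions that are smooth on `s`, all of whose derivatives are jointly continuous in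
the parameter and the point. The derivatives are the unrestricted ones, so that the notion is meant
for open `s`. -/
structure SmoothFamilyOn (h : T → X → Y) (s : Set X) : Prop where
  contDiffOn : ∀ t, ContDiffOn ℝ ∞ (h t) s
  continuousOn_iteratedFDeriv :
    ∀ k : ℕ, ContinuousOn (fun p : T × X => iteratedFDeriv ℝ k (h p.1) p.2) (univ ×ˢ s)

variable {s : Set X}

theorem smoothFamilyOn_const {f : X → Y} (hs : IsOpen s) (hf : ContDiffOn ℝ ∞ f s) :
    SmoothFamilyOn (fun _ : T => f) s where
  contDiffOn _ := hf
  continuousOn_iteratedFDeriv k :=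
    ((hf.continuousOn_iteratedFDerivWithin (mod_cast le_top) hs.uniqueDiffOn).congr
      (iteratedFDerivWithin_of_isOpen k hs).symm).comp continuousOn_snd fun _ hp => hp.2

namespace SmoothFamilyOn

theorem contDiffAt {h : T → X → Y} (hh : SmoothFamilyOn h s) (hs : IsOpen s) (n : ℕ) (t : T) {x : X}
    (hx : x ∈ s) : ContDiffAt ℝ n (h t) x :=
  ((hh.contDiffOn t).contDiffAt (hs.mem_nhds hx)).of_le (mod_cast le_top)

theorem continuousOn_uncurry {h : T → X → Y} (hh : SmoothFamilyOn h s) :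
    ContinuousOn (fun p : T × X => h p.1 p.2) (univ ×ˢ s) :=
  ((continuousMultilinearCurryFin0 ℝ X Y).continuous.comp_continuousOn
    (hh.continuousOn_iteratedFDeriv 0)).congr fun _ _ => by simp

theorem add {f g : T → X → Y} (hf : SmoothFamilyOn f s) (hg : SmoothFamilyOn g s) (hs : IsOpen s) :
    SmoothFamilyOn (fun t x => f t x + g t x) s where
  contDiffOn t := (hf.contDiffOn t).add (hg.contDiffOn t)
  continuousOn_iteratedFDeriv k :=
    ((hf.continuousOn_iteratedFDeriv k).add (hg.continuousOn_iteratedFDeriv k)).congr fun p hp =>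
      fun_iteratedFDeriv_add_apply (hf.contDiffAt hs k p.1 hp.2) (hg.contDiffAt hs k p.1 hp.2)

theorem clm_comp {f : T → X → Y} (hf : SmoothFamilyOn f s) (hs : IsOpen s) {ℓ : T → Y →L[ℝ] Z}
    (hℓ : Continuous ℓ) : SmoothFamilyOn (fun t x => ℓ t (f t x)) s where
  contDiffOn t := (ℓ t).contDiff.comp_contDiffOn (hf.contDiffOn t)
  continuousOn_iteratedFDeriv k := by
    have hcomp : Continuous fun p : T × X =>
        ContinuousLinearMap.compContinuousMultilinearMapL ℝ (fun _ : Fin k => X) Y Z (ℓ p.1) :=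
      (ContinuousLinearMap.continuous _).comp (hℓ.comp continuous_fst)
    exact (hcomp.continuousOn.clm_apply (hf.continuousOn_iteratedFDeriv k)).congr fun p hp =>
      (ℓ p.1).iteratedFDeriv_comp_left (hf.contDiffAt hs k p.1 hp.2) le_rfl

theorem neg {f : T → X → Y} (hf : SmoothFamilyOn f s) (hs : IsOpen s) :
    SmoothFamilyOn (fun t x => -f t x) s := by
  simpa using hf.clm_comp hs (ℓ := fun _ => -ContinuousLinearMap.id ℝ Y) continuous_const

theorem comp_continuous {T' : Type*} [TopologicalSpace T'] {f : T → X → Y}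
    (hf : SmoothFamilyOn f s) {g : T' → T} (hg : Continuous g) :
    SmoothFamilyOn (fun t => f (g t)) s where
  contDiffOn t := hf.contDiffOn (g t)
  continuousOn_iteratedFDeriv k :=
    (hf.continuousOn_iteratedFDeriv k).comp
      ((hg.comp continuous_fst).prodMk continuous_snd).continuousOn
      fun _ hp => ⟨mem_univ _, hp.2⟩

theorem sum {f : ι → T → X → Y} (hf : ∀ i, SmoothFamilyOn (f i) s) (hs : IsOpen s) (J : Finset ι) :
    SmoothFamilyOn (fun t x => ∑ i ∈ J, f i t x) s := by
  classical
  induction J using Finset.induction_on with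
  | empty => simpa using smoothFamilyOn_const hs (contDiffOn_const (c := (0 : Y)))
  | insert i J hi hJ => simpa only [Finset.sum_insert hi] using (hf i).add hJ hs

theorem of_locally {h : T → X → Y}
    (hloc : ∀ x ∈ s, ∃ U ∈ 𝓝 x, ∃ g, SmoothFamilyOn g s ∧ ∀ t, EqOn (h t) (g t) U) :
    SmoothFamilyOn h s where
  contDiffOn t x hx := by
    obtain ⟨U, hU, g, hg, hhg⟩ := hloc x hx
    exact (hg.contDiffOn t x hx).congr_of_eventuallyEq
      (((hhg t).eventuallyEq_of_mem hU).filter_mono nhdsWithin_le_nhds) (hhg t (mem_of_mem_nhds hU))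
  continuousOn_iteratedFDeriv k p hp := by
    obtain ⟨U, hU, g, hg, hhg⟩ := hloc p.2 hp.2
    have hderiv : (fun q : T × X => iteratedFDeriv ℝ k (h q.1) q.2) =ᶠ[𝓝 p]
        fun q => iteratedFDeriv ℝ k (g q.1) q.2 := by
      filter_upwards [continuousAt_snd (eventually_mem_nhds_iff.2 hU)] with q hq
      exact ((((hhg q.1).eventuallyEq_of_mem hq).iteratedFDeriv ℝ k)).eq_of_nhds
    exact (hg.continuousOn_iteratedFDeriv k p hp).congr_of_eventuallyEq
      (hderiv.filter_mono nhdsWithin_le_nhds) hderiv.eq_of_nhds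

theorem finsum {f : ι → T → X → Y} (hf : ∀ i, SmoothFamilyOn (f i) s) (hs : IsOpen s)
    (hfin : ∀ x ∈ s, ∃ U ∈ 𝓝 x, {i | ∃ t, ∃ y ∈ U, f i t y ≠ 0}.Finite) :
    SmoothFamilyOn (fun t x => ∑ᶠ i, f i t x) s := by
  refine of_locally fun x hx => ?_
  obtain ⟨U, hU, hJ⟩ := hfin x hx
  exact ⟨U, hU, _, sum hf hs hJ.toFinset, fun t y hy =>
    finsum_eq_sum_of_support_subset _ fun i hi => hJ.mem_toFinset.2 ⟨t, y, hy, hi⟩⟩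

theorem exists_continuous_abs_hessian_le {h : T → X → ℝ} (hh : SmoothFamilyOn h s) {K : Set X}
    (hK : IsCompact K) (hKs : K ⊆ s) :
    ∃ c : T → ℝ, Continuous c ∧ (∀ t, 0 ≤ c t) ∧
      ∀ t, ∀ x ∈ K, ∀ w, |hessian (h t) x w| ≤ c t * ‖w‖ ^ 2 := by
  let D : T → K → ℝ := fun t x => ‖iteratedFDeriv ℝ 2 (h t) x‖
  have hD : Continuous fun p : T × K => D p.1 p.2 :=
    ((hh.continuousOn_iteratedFDeriv 2).comp_continuous
      (f := fun p : T × K => (p.1, (p.2 : X))) (by fun_prop) fun p => ⟨mem_univ _, hKs p.2.2⟩).norm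
  have := isCompact_iff_compactSpace.1 hK
  refine ⟨fun t => sSup (D t '' univ), isCompact_univ.continuous_sSup hD, fun t => ?_,
    fun t x hx w => ?_⟩
  · exact Real.sSup_nonneg (by rintro _ ⟨x, -, rfl⟩; exact norm_nonneg _)
  · have hDt : BddAbove (D t '' univ) :=
      (isCompact_univ.image (hD.comp (Continuous.prodMk_right t))).bddAbove
    calc |hessian (h t) x w| ≤ ‖iteratedFDeriv ℝ 2 (h t) x‖ * ∏ _i : Fin 2, ‖w‖ :=
          (iteratedFDeriv ℝ 2 (h t) x).le_opNorm _
      _ = D t ⟨x, hx⟩ * ‖w‖ ^ 2 := by simp [D]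
      _ ≤ sSup (D t '' univ) * ‖w‖ ^ 2 := by
          gcongr
          exact le_csSup hDt (mem_image_of_mem _ (mem_univ _))

theorem convergesWithSecondDerivs {d : ℕ} {h : T → E d → ℝ} (hh : SmoothFamilyOn h (B d))
    {u : ℕ → T} {t : T} (hu : Tendsto u atTop (𝓝 t)) :
    ConvergesWithSecondDerivs (fun n => h (u n)) (h t) :=
  ⟨tendstoLocallyUniformlyOn_of_continuousOn hh.continuousOn_uncurry hu,
    tendstoLocallyUniformlyOn_of_continuousOn (F := fun t => iteratedFDeriv ℝ 2 (h t))
      (hh.continuousOn_iteratedFDeriv 2) hu⟩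

end SmoothFamilyOn

end SmoothFamily

section Geometry

variable {d : ℕ}

/-- The Minkowski form as a continuous bilinear map. -/
noncomputable def minkCLM : V d →L[ℝ] V d →L[ℝ] ℝ :=
  isBoundedBilinearMap_inner.toContinuousLinearMap.bilinearComp
      (ContinuousLinearMap.fst ℝ (E d) ℝ) (ContinuousLinearMap.fst ℝ (E d) ℝ) -
    (ContinuousLinearMap.mul ℝ ℝ).bilinearComp (ContinuousLinearMap.snd ℝ (E d) ℝ)
      (ContinuousLinearMap.snd ℝ (E d) ℝ)

theorem minkCLM_apply (p q : V d) : minkCLM p q = mink p q := rfl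

theorem mink_smul_left (c : ℝ) (p q : V d) : mink (c • p) q = c * mink p q := by
  simp only [← minkCLM_apply, map_smul, smul_apply, smul_eq_mul]

theorem mink_smul_right (c : ℝ) (p q : V d) : mink p (c • q) = c * mink p q := by
  simp only [← minkCLM_apply, map_smul, smul_eq_mul]

theorem mink_self (p : V d) : mink p p = ‖p.1‖ ^ 2 - p.2 ^ 2 := by
  rw [mink, real_inner_self_eq_norm_sq, pow_two p.2]

/-- The open cone of future timelike vectors, that is, the cone over `ℋ^d`. -/
def futureCone (d : ℕ) : Set (V d) := {p | mink p p < 0 ∧ 0 < p.2}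

theorem isOpen_futureCone : IsOpen (futureCone d) := by
  have hcont : Continuous fun p : V d => mink p p := by
    simp only [mink]
    fun_prop
  exact (isOpen_lt hcont continuous_const).inter (isOpen_lt continuous_const continuous_snd)

theorem hyperboloid_subset_futureCone : hyperboloid d ⊆ futureCone d := fun _ hp =>
  ⟨hp.1.trans_lt (by norm_num), hp.2⟩

theorem inv_sqrt_smul_mem_hyperboloid {p : V d} (hp : p ∈ futureCone d) :
    (√(-mink p p))⁻¹ • p ∈ hyperboloid d := by
  have hpos : 0 < -mink p p := neg_pos.2 hp.1
  refine ⟨?_, mul_pos (inv_pos.2 (Real.sqrt_pos.2 hpos)) hp.2⟩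
  rw [mink_smul_left, mink_smul_right, ← mul_assoc, ← mul_inv, Real.mul_self_sqrt hpos.le,
    inv_neg, neg_mul, inv_mul_cancel₀ hp.1.ne]

theorem map_mem_futureCone (A : OPlus d) {p : V d} (hp : p ∈ futureCone d) :
    A.1 p ∈ futureCone d := by
  refine ⟨(A.2.1 p p).trans_lt hp.1, ?_⟩
  have hA : A.1 ((√(-mink p p))⁻¹ • p) ∈ hyperboloid d :=
    A.2.2.subset (mem_image_of_mem A.1 (inv_sqrt_smul_mem_hyperboloid hp))
  rw [map_smul] at hA
  exact pos_of_mul_pos_right hA.2 (inv_nonneg.2 (Real.sqrt_nonneg _))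

theorem proj_mem_ball {p : V d} (hp : p ∈ futureCone d) : proj p ∈ B d := by
  rw [B, mem_ball_zero_iff, proj, norm_smul, norm_inv, Real.norm_of_nonneg hp.2.le,
    inv_mul_lt_one₀ hp.2]
  refine lt_of_pow_lt_pow_left₀ 2 hp.2.le ?_
  linarith [hp.1, mink_self p]

theorem prodMk_one_mem_futureCone {x : E d} (hx : x ∈ B d) : (x, (1 : ℝ)) ∈ futureCone d := by
  rw [B, mem_ball_zero_iff] at hx
  refine ⟨?_, one_pos⟩
  rw [mink_self]
  nlinarith [norm_nonneg x]

theorem perspective_L {p : V d} (hp : 0 < p.2) : perspective L p = √(-mink p p) := by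
  have hnorm : p.2 * ‖proj p‖ = ‖p.1‖ := by
    rw [proj, norm_smul, norm_inv, Real.norm_of_nonneg hp.le, mul_inv_cancel_left₀ hp.ne']
  calc p.2 * √(1 - ‖proj p‖ ^ 2) = √(p.2 ^ 2 * (1 - ‖proj p‖ ^ 2)) := by
        rw [Real.sqrt_mul (sq_nonneg _), Real.sqrt_sq hp.le]
    _ = √(-mink p p) := by rw [mink_self, ← hnorm]; ring_nf

theorem perspective_L_map (A : OPlus d) {p : V d} (hp : p ∈ futureCone d) :
    perspective L (A.1 p) = perspective L p := by
  rw [perspective_L (map_mem_futureCone A hp).2, perspective_L hp.2, A.2.1]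

theorem L_pos {x : E d} (hx : x ∈ B d) : 0 < L x := by
  rw [← perspective_prodMk_one L x, perspective_L one_pos]
  exact Real.sqrt_pos.2 (neg_pos.2 (prodMk_one_mem_futureCone hx).1)

theorem L_le_one (x : E d) : L x ≤ 1 :=
  Real.sqrt_le_one.2 (sub_le_self 1 (sq_nonneg _))

theorem contDiffOn_L : ContDiffOn ℝ ∞ (L (d := d)) (B d) := fun _ hx =>
  ((contDiffAt_const.sub (contDiffAt_id.norm_sq ℝ)).sqrt
    (Real.sqrt_pos.1 (L_pos hx)).ne').contDiffWithinAt

theorem hasFDerivAt_L {x : E d} (hx : x ∈ B d) :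
    HasFDerivAt L (-(L x)⁻¹ • innerSL ℝ x) x := by
  have hsq : HasFDerivAt (fun y : E d => 1 - ‖y‖ ^ 2) (-(2 • innerSL ℝ x)) x :=
    (hasStrictFDerivAt_norm_sq x).hasFDerivAt.const_sub 1
  refine (hsq.sqrt (Real.sqrt_pos.1 (L_pos hx)).ne').congr_fderiv ?_
  ext w
  simp only [L, one_div, mul_inv_rev, smul_neg, neg_smul, neg_apply, neg_inj, smul_apply,
    coe_innerSL_apply, nsmul_eq_mul, smul_eq_mul, Nat.cast_ofNat]
  ring

theorem hessian_L {x : E d} (hx : x ∈ B d) (w : E d) :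
    hessian L x w = -(‖w‖ ^ 2 / L x + inner ℝ x w ^ 2 / L x ^ 3) := by
  have hB : IsOpen (B d) := Metric.isOpen_ball
  have hLx : L x ≠ 0 := (L_pos hx).ne'
  have hL : HasDerivAt (fun t : ℝ => L (x + t • w)) (-(L x)⁻¹ * inner ℝ x w) 0 :=
    HasFDerivAt.comp_hasDerivAt_of_eq 0 (hasFDerivAt_L hx) (hasDerivAt_add_smul x w 0) (by simp)
  have hinner : HasDerivAt (fun t : ℝ => inner ℝ (x + t • w) w) (‖w‖ ^ 2) 0 := by
    simpa using (hasDerivAt_add_smul x w 0).inner ℝ (hasDerivAt_const 0 w)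
  have hderiv := (hL.fun_inv (by simpa using hLx)).fun_neg.mul hinner
  refine hessian_eq_of_hasFDerivAt (f' := fun y => -(L y)⁻¹ • innerSL ℝ y)
    ((contDiffOn_L.contDiffAt (hB.mem_nhds hx)).of_le (by norm_cast)) ?_
    (hderiv.congr_deriv ?_)
  · filter_upwards [hB.mem_nhds hx] with y hy using hasFDerivAt_L hy
  · simp only [zero_smul, add_zero]
    field_simp
    ring

theorem hessian_L_le {x : E d} (hx : x ∈ B d) (w : E d) : hessian L x w ≤ -‖w‖ ^ 2 := by
  have hL := L_pos hx
  have hdiv : ‖w‖ ^ 2 ≤ ‖w‖ ^ 2 / L x := le_div_self (sq_nonneg _) hL (L_le_one x)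
  have hinner : 0 ≤ inner ℝ x w ^ 2 / L x ^ 3 := by positivity
  rw [hessian_L hx]
  linarith

theorem proj_map (A : OPlus d) {p : V d} (hp : p.2 ≠ 0) : proj (A.1 p) = klein A (proj p) := by
  conv_lhs => rw [← smul_proj hp, map_smul, proj_smul hp]
  rfl

theorem klein_mem_ball (A : OPlus d) {x : E d} (hx : x ∈ B d) : klein A x ∈ B d :=
  proj_mem_ball (map_mem_futureCone A (prodMk_one_mem_futureCone hx))

theorem klein_mul (A C : OPlus d) {x : E d} (hx : x ∈ B d) :
    klein (A * C) x = klein A (klein C x) :=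
  proj_map A (map_mem_futureCone C (prodMk_one_mem_futureCone hx)).2.ne'

theorem klein_one (x : E d) : klein (1 : OPlus d) x = x := proj_prodMk_one x

theorem contDiffOn_klein (A : OPlus d) : ContDiffOn ℝ ∞ (klein A) (B d) := fun x hx =>
  ((contDiffAt_proj (map_mem_futureCone A (prodMk_one_mem_futureCone hx)).2.ne').comp x
    ((A.1.toContinuousLinearEquiv.contDiff.comp
      (contDiff_id.prodMk contDiff_const)).contDiffAt)).contDiffWithinAt

theorem act_eq_perspective (A : OPlus d) (v : V d) (h : E d → ℝ) {x : E d} (hx : x ∈ B d) :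
    act A v h x = perspective h (A⁻¹.1 (x, 1)) + mink (x, 1) v := by
  have hL : L x = (A⁻¹.1 (x, 1)).2 * L (klein A⁻¹ x) := by
    rw [← perspective_prodMk_one L x, ← perspective_L_map A⁻¹ (prodMk_one_mem_futureCone hx)]
    rfl
  rw [act, hL, mul_div_cancel_right₀ _ (L_pos (klein_mem_ball A⁻¹ hx)).ne', perspective, mink,
    one_mul, add_sub_assoc]
  rfl

theorem act_sub_const_mul_L (A : OPlus d) (v : V d) (h : E d → ℝ) (c : ℝ) {x : E d}
    (hx : x ∈ B d) : act A v (fun y => h y - c * L y) x = act A v h x - c * L x := by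
  rw [act_eq_perspective A v _ hx, act_eq_perspective A v h hx, perspective_sub_const_mul,
    perspective_L_map A⁻¹ (prodMk_one_mem_futureCone hx), perspective_prodMk_one]
  ring

theorem perspective_eq_of_act_eq {A : OPlus d} {v : V d} {h : E d → ℝ}
    (hh : EqOn (act A v h) h (B d)) {p : V d} (hp : p ∈ futureCone d) :
    perspective h p = perspective h (A⁻¹.1 p) + mink p v := by
  have hp2 : p.2 ≠ 0 := hp.2.ne'
  have hact := act_eq_perspective A v h (proj_mem_ball hp)
  rw [hh (proj_mem_ball hp), ← perspective_prodMk_one h (proj p)] at hact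
  rw [← smul_proj hp2, map_smul, perspective_smul h hp2, perspective_smul h hp2, mink_smul_left,
    hact, mul_add]

theorem hessian_eq_mul_hessian_klein {A : OPlus d} {v : V d} {h : E d → ℝ}
    (hh : ContDiffOn ℝ 2 h (B d)) (hact : EqOn (act A v h) h (B d)) {x : E d} (hx : x ∈ B d)
    (w : E d) :
    hessian h x w = (A⁻¹.1 (x, 1)).2⁻¹ * hessian h (klein A⁻¹ x)
      ((A⁻¹.1 (w, 0)).1 - (A⁻¹.1 (w, 0)).2 • klein A⁻¹ x) := by
  obtain ⟨M, hM⟩ : ∃ M : V d →L[ℝ] V d, ∀ p, M p = A⁻¹.1 p :=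
    ⟨A⁻¹.1.toContinuousLinearEquiv, fun _ => rfl⟩
  have hxcone : (x, (1 : ℝ)) ∈ futureCone d := prodMk_one_mem_futureCone hx
  have hMx : (M (x, 1)).2 ≠ 0 := by
    rw [hM]
    exact (map_mem_futureCone A⁻¹ hxcone).2.ne'
  have hsmooth : ∀ y ∈ B d, ContDiffAt ℝ 2 h y := fun y hy =>
    hh.contDiffAt (Metric.isOpen_ball.mem_nhds hy)
  have hsmooth_x : ContDiffAt ℝ 2 h (proj (x, (1 : ℝ))) := hsmooth _ (proj_mem_ball hxcone)
  have hklein : klein A⁻¹ x = proj (M (x, 1)) := by rw [hM]; rfl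
  have hsmooth_Mx : ContDiffAt ℝ 2 h (proj (M (x, 1))) :=
    hsmooth _ (hklein ▸ klein_mem_ball A⁻¹ hx)
  have hcone : perspective h =ᶠ[𝓝 (x, 1)] fun p => perspective h (M p) + minkCLM.flip v p := by
    filter_upwards [isOpen_futureCone.mem_nhds hxcone] with p hp
    rw [hM]
    exact perspective_eq_of_act_eq hact hp
  calc hessian h x w = hessian (perspective h) (x, 1) (w, 0) := by
        rw [hessian_perspective one_ne_zero hsmooth_x]
        simp [proj_prodMk_one]
    _ = hessian (perspective h) (M (x, 1)) (M (w, 0)) :=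
        hessian_eq_of_eventuallyEq_comp_add M _ (contDiffAt_perspective hMx hsmooth_Mx) hcone _
    _ = _ := by rw [hessian_perspective hMx hsmooth_Mx, hklein, hM, hM]

theorem hessian_nonneg_of_klein {A : OPlus d} {v : V d} {h : E d → ℝ}
    (hh : ContDiffOn ℝ 2 h (B d)) (hact : EqOn (act A v h) h (B d)) {x : E d} (hx : x ∈ B d)
    (hpos : ∀ w, 0 ≤ hessian h (klein A⁻¹ x) w) (w : E d) : 0 ≤ hessian h x w := by
  rw [hessian_eq_mul_hessian_klein hh hact hx]
  exact mul_nonneg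
    (inv_nonneg.2 (map_mem_futureCone A⁻¹ (prodMk_one_mem_futureCone hx)).2.le) (hpos _)

end Geometry

section Cocompact

theorem exists_isCompact_forall_smul_mem (G X : Type*) [Group G] [TopologicalSpace X]
    [MulAction G X] [ContinuousConstSMul G X] [WeaklyLocallyCompactSpace X]
    [CompactSpace (MulAction.orbitRel.Quotient G X)] :
    ∃ K : Set X, IsCompact K ∧ ∀ x, ∃ g : G, g • x ∈ K := by
  choose N hN hxN using fun x : X => exists_compact_mem_nhds x
  let π : X → MulAction.orbitRel.Quotient G X := Quotient.mk''
  have hπ : IsOpenMap π := isOpenMap_quotient_mk'_mul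
  obtain ⟨t, -, ht⟩ := isCompact_univ.elim_nhds_subcover (fun q => π '' N q.out) fun q _ => by
    simpa [π] using hπ.image_mem_nhds (hxN q.out)
  refine ⟨⋃ q ∈ t, N q.out, t.isCompact_biUnion fun q _ => hN q.out, fun x => ?_⟩
  obtain ⟨q, hq, y, hy, hyx⟩ := mem_iUnion₂.1 (ht (mem_univ (π x)))
  obtain ⟨g, rfl⟩ := MulAction.orbitRel_apply.1 (Quotient.eq''.1 hyx)
  exact ⟨g, mem_iUnion₂.2 ⟨q, hq, hy⟩⟩

variable {d : ℕ}

/-- The central projection of the hyperboloid onto the Klein ball model. -/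
noncomputable def kleinHomeomorph (d : ℕ) : hyperboloid d ≃ₜ B d where
  toFun p := ⟨proj p.1, proj_mem_ball (hyperboloid_subset_futureCone p.2)⟩
  invFun x := ⟨(L x.1)⁻¹ • (x.1, 1), by
    have hx := inv_sqrt_smul_mem_hyperboloid (prodMk_one_mem_futureCone x.2)
    rwa [← perspective_L one_pos, perspective_prodMk_one] at hx⟩
  left_inv p := by
    have hL : p.1.2 * L (proj p.1) = 1 := by
      rw [← perspective, perspective_L p.2.2, p.2.1, neg_neg, Real.sqrt_one]
    ext1
    simp only [← eq_inv_of_mul_eq_one_left hL, smul_proj p.2.2.ne']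
  right_inv x := by
    ext1
    simp only [proj_smul (inv_ne_zero (L_pos x.2).ne'), proj_prodMk_one]
  continuous_toFun := by
    refine Continuous.subtype_mk (continuous_iff_continuousAt.2 fun p => ?_) _
    exact (contDiffAt_proj (n := 0) p.2.2.ne').continuousAt.comp continuousAt_subtype_val
  continuous_invFun := by
    have hL : Continuous fun x : B d => L x.1 := contDiffOn_L.continuousOn.domRestrict
    exact ((hL.inv₀ fun x => (L_pos x.2).ne').smul (by fun_prop)).subtype_mk _

theorem kleinHomeomorph_smul (A : OPlus d) (p : hyperboloid d) :
    (kleinHomeomorph d (A • p) : E d) = klein A (kleinHomeomorph d p) :=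
  proj_map A p.2.2.ne'

instance (Γ : Subgroup (OPlus d)) : ContinuousConstSMul Γ (hyperboloid d) where
  continuous_const_smul A :=
    (A.1.1.toContinuousLinearEquiv.continuous.comp continuous_subtype_val).subtype_mk _

instance : LocallyCompactSpace (hyperboloid d) :=
  have : LocallyCompactSpace (B d) := Metric.isOpen_ball.locallyCompactSpace
  (kleinHomeomorph d).isOpenEmbedding.locallyCompactSpace

variable (Γ : Subgroup (OPlus d))

theorem exists_forall_klein_inv_mem_closedBall
    [CompactSpace (MulAction.orbitRel.Quotient Γ (hyperboloid d))] :
    ∃ r ∈ Ioo (0 : ℝ) 1, ∀ x ∈ B d, ∃ A : Γ, klein A.1⁻¹ x ∈ Metric.closedBall 0 r := by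
  obtain ⟨K, hK, hΓK⟩ := exists_isCompact_forall_smul_mem Γ (hyperboloid d)
  have hK' : IsCompact ((fun p => (kleinHomeomorph d p : E d)) '' K) :=
    hK.image (continuous_subtype_val.comp (kleinHomeomorph d).continuous)
  obtain ⟨r, hr, hKr⟩ := exists_pos_lt_subset_ball one_pos hK'.isClosed
    (image_subset_iff.2 fun p _ => (kleinHomeomorph d p).2)
  refine ⟨r, hr, fun x hx => ?_⟩
  obtain ⟨A, hA⟩ := hΓK ((kleinHomeomorph d).symm ⟨x, hx⟩)
  refine ⟨A⁻¹, Metric.ball_subset_closedBall (hKr ⟨_, hA, ?_⟩)⟩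
  change (kleinHomeomorph d (A.1 • _) : E d) = _
  rw [kleinHomeomorph_smul, Homeomorph.apply_symm_apply, InvMemClass.coe_inv, inv_inv]

theorem finite_setOf_exists_klein_inv_mem [ProperlyDiscontinuousSMul Γ (hyperboloid d)]
    {K K' : Set (E d)} (hK : IsCompact K) (hKB : K ⊆ B d) (hK' : IsCompact K') (hKB' : K' ⊆ B d) :
    {A : Γ | ∃ x ∈ K, klein A.1⁻¹ x ∈ K'}.Finite := by
  let lift (S : Set (E d)) : Set (hyperboloid d) := kleinHomeomorph d ⁻¹' (Subtype.val ⁻¹' S)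
  have hlift : ∀ S : Set (E d), IsCompact S → S ⊆ B d → IsCompact (lift S) := fun S hS hSB =>
    (kleinHomeomorph d).isCompact_preimage.2
      (Topology.IsInducing.subtypeVal.isCompact_preimage_iff (by simpa using hSB) |>.2 hS)
  refine (ProperlyDiscontinuousSMul.finite_disjoint_inter_image (hlift K' hK' hKB')
    (hlift K hK hKB)).subset ?_
  rintro A ⟨x, hx, hAx⟩
  refine ⟨_, ⟨(kleinHomeomorph d).symm ⟨_, hKB' hAx⟩, ?_, rfl⟩, ?_⟩
  · simpa [lift] using hAx
  · change (kleinHomeomorph d (A.1 • _) : E d) ∈ K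
    rwa [kleinHomeomorph_smul, Homeomorph.apply_symm_apply, ← klein_mul _ _ (hKB hx),
      mul_inv_cancel, klein_one]

end Cocompact

section OrbitPartition

variable {d : ℕ} {Γ : Subgroup (OPlus d)}

/-- The translates `ψ (A⁻¹ · x)`, for `A` in `Γ`, form a locally finite family on the ball. -/
def HasLocallyFiniteOrbit (Γ : Subgroup (OPlus d)) (ψ : E d → ℝ) : Prop :=
  ∀ x ∈ B d, ∃ U ∈ 𝓝 x, {A : Γ | ∃ y ∈ U, ψ (klein A.1⁻¹ y) ≠ 0}.Finite

/-- The translates of `φ` under `Γ` form a smooth, locally finite partition of unity on the ball. -/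
structure IsOrbitPartition (Γ : Subgroup (OPlus d)) (φ : E d → ℝ) : Prop where
  contDiffOn : ContDiffOn ℝ ∞ φ (B d)
  hasLocallyFiniteOrbit : HasLocallyFiniteOrbit Γ φ
  finsum_eq_one : ∀ x ∈ B d, ∑ᶠ A : Γ, φ (klein A.1⁻¹ x) = 1

namespace HasLocallyFiniteOrbit

theorem of_support_subset_isCompact [ProperlyDiscontinuousSMul Γ (hyperboloid d)] {ψ : E d → ℝ}
    {K : Set (E d)} (hK : IsCompact K) (hKB : K ⊆ B d) (hψ : Function.support ψ ⊆ K) :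
    HasLocallyFiniteOrbit Γ ψ := by
  intro x hx
  obtain ⟨N, hN, hxN, hNB⟩ := exists_compact_subset Metric.isOpen_ball hx
  refine ⟨N, mem_interior_iff_mem_nhds.1 hxN,
    (finite_setOf_exists_klein_inv_mem Γ hN hNB hK hKB).subset ?_⟩
  rintro A ⟨y, hy, hAy⟩
  exact ⟨y, hy, hψ hAy⟩

theorem hasFiniteSupport {ψ : E d → ℝ} (hψ : HasLocallyFiniteOrbit Γ ψ) {x : E d} (hx : x ∈ B d) :
    (fun A : Γ => ψ (klein A.1⁻¹ x)).HasFiniteSupport := by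
  obtain ⟨U, hU, hfin⟩ := hψ x hx
  exact hfin.subset fun A hA => ⟨x, mem_of_mem_nhds hU, hA⟩

theorem smoothFamilyOn_finsum {T : Type*} [TopologicalSpace T] {ψ : E d → ℝ}
    (hψ : HasLocallyFiniteOrbit Γ ψ) (hsmooth : ContDiffOn ℝ ∞ ψ (B d))
    {F : Γ → T → V d →L[ℝ] ℝ} (hF : ∀ A, Continuous (F A)) :
    SmoothFamilyOn (fun t x => ∑ᶠ A : Γ, ψ (klein A.1⁻¹ x) * F A t (x, 1)) (B d) := by
  have hB : IsOpen (B d) := Metric.isOpen_ball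
  refine SmoothFamilyOn.finsum (fun A => ?_) hB fun x hx => ?_
  · have hterm : ContDiffOn ℝ ∞ (fun x : E d => ψ (klein A.1⁻¹ x) • (x, (1 : ℝ))) (B d) :=
      (hsmooth.comp (contDiffOn_klein A.1⁻¹) fun _ => klein_mem_ball A.1⁻¹).smul
        (contDiff_id.prodMk contDiff_const).contDiffOn
    simpa only [map_smul, smul_eq_mul] using
      (smoothFamilyOn_const hB hterm).clm_comp hB (hF A)
  · obtain ⟨U, hU, hfin⟩ := hψ x hx
    exact ⟨U, hU, hfin.subset fun A ⟨_, y, hy, hne⟩ => ⟨y, hy, left_ne_zero_of_mul hne⟩⟩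

end HasLocallyFiniteOrbit

theorem finsum_klein_klein_inv {M : Type*} [AddCommMonoid M] (C : Γ) (f : E d → Γ → M) {x : E d}
    (hx : x ∈ B d) :
    ∑ᶠ A : Γ, f (klein A.1⁻¹ (klein C.1⁻¹ x)) (C * A) = ∑ᶠ A : Γ, f (klein A.1⁻¹ x) A := by
  rw [← finsum_comp_equiv (Equiv.mulLeft C) (f := fun A : Γ => f (klein A.1⁻¹ x) A)]
  refine finsum_congr fun A => ?_
  rw [← klein_mul _ _ hx, ← mul_inv_rev]
  rfl

theorem exists_isOrbitPartition (Γ : Subgroup (OPlus d))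
    [ProperlyDiscontinuousSMul Γ (hyperboloid d)]
    [CompactSpace (MulAction.orbitRel.Quotient Γ (hyperboloid d))] :
    ∃ φ : E d → ℝ, IsOrbitPartition Γ φ := by
  obtain ⟨r, ⟨hr, hr1⟩, hΓr⟩ := exists_forall_klein_inv_mem_closedBall Γ
  obtain ⟨R, hrR, hR1⟩ := exists_between hr1
  let ψ : ContDiffBump (0 : E d) := ⟨r, R, hr, hrR⟩
  let total (x : E d) : ℝ := ∑ᶠ A : Γ, ψ (klein A.1⁻¹ x)
  have hψ : HasLocallyFiniteOrbit Γ ψ := .of_support_subset_isCompact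
    (isCompact_closedBall 0 R) (Metric.closedBall_subset_ball hR1)
    (ψ.support_eq.trans_subset Metric.ball_subset_closedBall)
  have htotal : ContDiffOn ℝ ∞ total (B d) := by
    simpa [total] using (hψ.smoothFamilyOn_finsum ψ.contDiff.contDiffOn (T := Unit)
      (F := fun _ _ => ContinuousLinearMap.snd ℝ (E d) ℝ) fun _ => continuous_const).contDiffOn ()
  have htotal_pos : ∀ x ∈ B d, 0 < total x := fun x hx => by
    obtain ⟨A, hA⟩ := hΓr x hx
    exact finsum_pos (fun _ => ψ.nonneg)
      ⟨A, by rw [ψ.one_of_mem_closedBall hA]; exact one_pos⟩ (hψ.hasFiniteSupport hx)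
  have htotal_klein : ∀ A : Γ, ∀ x ∈ B d, total (klein A.1⁻¹ x) = total x := fun A x hx =>
    finsum_klein_klein_inv A (fun y _ => ψ y) hx
  refine ⟨fun x => ψ x / total x, ?_, fun x hx => ?_, fun x hx => ?_⟩
  · exact ψ.contDiff.contDiffOn.div htotal fun x hx => (htotal_pos x hx).ne'
  · obtain ⟨U, hU, hfin⟩ := hψ x hx
    exact ⟨U, hU, hfin.subset fun A ⟨y, hy, hne⟩ => ⟨y, hy, fun h => hne (by rw [h, zero_div])⟩⟩
  · simp only [htotal_klein _ x hx, div_eq_mul_inv]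
    rw [← finsum_mul, mul_inv_cancel₀ (htotal_pos x hx).ne']

end OrbitPartition

section Average

variable {d : ℕ} {Γ : Subgroup (OPlus d)}

/-- The average of the affine functions `x ↦ ⟨(x, 1), τ A⟩`, weighted by the translates of `φ`. For
an orbit partition `φ` it is `τ`-equivariant, since `A` maps the graph of the zero function to the
graph of `x ↦ ⟨(x, 1), τ A⟩`. -/
noncomputable def average (φ : E d → ℝ) (τ : Z1 Γ) (x : E d) : ℝ :=
  ∑ᶠ A : Γ, φ (klein A.1⁻¹ x) * mink (x, 1) (τ.1 A)

namespace IsOrbitPartition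

variable {φ : E d → ℝ}

theorem act_average (hφ : IsOrbitPartition Γ φ) (τ : Z1 Γ) (C : Γ) {x : E d} (hx : x ∈ B d) :
    act C.1 (τ.1 C) (average φ τ) x = average φ τ x := by
  let p : V d := C.1⁻¹.1 (x, 1)
  have hp : p.2 ≠ 0 := (map_mem_futureCone C.1⁻¹ (prodMk_one_mem_futureCone hx)).2.ne'
  have hcocycle : ∀ A, mink p (τ.1 A) = mink (x, 1) (τ.1 (C * A)) - mink (x, 1) (τ.1 C) := by
    intro A
    have hCp : C.1.1 p = (x, 1) := C.1.1.apply_symm_apply _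
    rw [τ.2 C A, ← C.1.2.1 p, hCp]
    simp only [← minkCLM_apply, map_add]
    ring
  have hfin := hφ.hasLocallyFiniteOrbit.hasFiniteSupport hx
  have hpersp : perspective (average φ τ) p = average φ τ x - mink (x, 1) (τ.1 C) := by
    calc perspective (average φ τ) p
        = ∑ᶠ A : Γ, φ (klein A.1⁻¹ (klein C.1⁻¹ x)) * mink p (τ.1 A) := by
          rw [perspective, average, mul_finsum]
          refine finsum_congr fun A => ?_
          conv_rhs => rw [← smul_proj hp, mink_smul_left]
          rw [mul_left_comm]
          rfl
      _ = ∑ᶠ A : Γ, φ (klein A.1⁻¹ x) * (mink (x, 1) (τ.1 A) - mink (x, 1) (τ.1 C)) := by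
          simp only [hcocycle]
          exact finsum_klein_klein_inv C
            (fun y A => φ y * (mink (x, 1) (τ.1 A) - mink (x, 1) (τ.1 C))) hx
      _ = average φ τ x - mink (x, 1) (τ.1 C) := by
          simp only [mul_sub]
          rw [finsum_sub_distrib (hfin.subset (Function.support_mul_subset_left _ _))
            (hfin.subset (Function.support_mul_subset_left _ _)), ← finsum_mul,
            hφ.finsum_eq_one x hx, one_mul, average]
  rw [act_eq_perspective C.1 _ _ hx, hpersp, sub_add_cancel]

theorem smoothFamilyOn_average (hφ : IsOrbitPartition Γ φ) :
    SmoothFamilyOn (average (Γ := Γ) φ) (B d) :=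
  hφ.hasLocallyFiniteOrbit.smoothFamilyOn_finsum hφ.contDiffOn
    (F := fun A (τ : Z1 Γ) => minkCLM.flip (τ.1 A)) fun A =>
      minkCLM.flip.continuous.comp ((continuous_apply A).comp continuous_subtype_val)

end IsOrbitPartition

end Average

section Main

variable {d : ℕ} {Γ : Subgroup (OPlus d)}

theorem SmoothFamilyOn.sub_mul_L {T : Type*} [TopologicalSpace T] {f : T → E d → ℝ}
    (hf : SmoothFamilyOn f (B d)) {c : T → ℝ} (hc : Continuous c) :
    SmoothFamilyOn (fun t x => f t x - c t * L x) (B d) := by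
  have hB : IsOpen (B d) := Metric.isOpen_ball
  have hcL := (smoothFamilyOn_const hB contDiffOn_L).clm_comp hB
    (ℓ := fun t => (-c t) • ContinuousLinearMap.id ℝ ℝ) (hc.neg.smul continuous_const)
  simpa [sub_eq_add_neg] using hf.add hcL hB

theorem IsEquivariant.neg {τ : Z1 Γ} {h : E d → ℝ} (hh : IsEquivariant (-τ) h) :
    IsEquivariant τ fun x => -h x := by
  refine ⟨hh.1.neg, fun A x hx => ?_⟩
  have hA := hh.2 A x hx
  simp only [act, NegMemClass.coe_neg, Pi.neg_apply, Prod.fst_neg, Prod.snd_neg,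
    inner_neg_right] at hA ⊢
  linarith

theorem convexOn_of_hessian_nonneg_of_klein {h : E d → ℝ} (hh : ContDiffOn ℝ 2 h (B d))
    {v : Γ → V d} (hact : ∀ A : Γ, EqOn (act A.1 (v A) h) h (B d)) {K : Set (E d)}
    (hΓK : ∀ x ∈ B d, ∃ A : Γ, klein A.1⁻¹ x ∈ K) (hpos : ∀ x ∈ K, ∀ w, 0 ≤ hessian h x w) :
    ConvexOn ℝ (B d) h := by
  refine convexOn_of_hessian_nonneg Metric.isOpen_ball (convex_ball 0 1) hh fun x hx => ?_
  obtain ⟨A, hA⟩ := hΓK x hx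
  exact hessian_nonneg_of_klein hh (hact A) hx (hpos _ hA)

theorem hessian_sub_const_mul_L_nonneg {f : E d → ℝ} {x : E d} (hx : x ∈ B d)
    (hf : ContDiffAt ℝ 2 f x) {c : ℝ} (hc : 0 ≤ c) {w : E d}
    (hfc : |hessian f x w| ≤ c * ‖w‖ ^ 2) : 0 ≤ hessian (fun y => f y - c * L y) x w := by
  have hL : ContDiffAt ℝ 2 L x :=
    (contDiffOn_L.contDiffAt (Metric.isOpen_ball.mem_nhds hx)).of_le (by norm_cast)
  rw [hessian_sub_const_mul hf hL]
  have hcL : c * hessian L x w ≤ c * -‖w‖ ^ 2 := mul_le_mul_of_nonneg_left (hessian_L_le hx w) hc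
  linarith [neg_le_of_abs_le hfc]

theorem exists_smoothFamilyOn_convexOn_isEquivariant (Γ : Subgroup (OPlus d))
    [ProperlyDiscontinuousSMul Γ (hyperboloid d)]
    [CompactSpace (MulAction.orbitRel.Quotient Γ (hyperboloid d))] :
    ∃ h : Z1 Γ → E d → ℝ, SmoothFamilyOn h (B d) ∧
      ∀ τ, ConvexOn ℝ (B d) (h τ) ∧ IsEquivariant τ (h τ) := by
  obtain ⟨r, ⟨-, hr1⟩, hΓr⟩ := exists_forall_klein_inv_mem_closedBall Γ
  obtain ⟨φ, hφ⟩ := exists_isOrbitPartition Γ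
  have hrB : Metric.closedBall 0 r ⊆ B d := Metric.closedBall_subset_ball hr1
  have havg := hφ.smoothFamilyOn_average
  obtain ⟨c, hc, hc0, hbound⟩ :=
    havg.exists_continuous_abs_hessian_le (isCompact_closedBall 0 r) hrB
  let h (τ : Z1 Γ) (x : E d) : ℝ := average φ τ x - c τ * L x
  have hh : SmoothFamilyOn h (B d) := havg.sub_mul_L hc
  have hact : ∀ τ, ∀ A : Γ, EqOn (act A.1 (τ.1 A) (h τ)) (h τ) (B d) := fun τ A x hx => by
    rw [act_sub_const_mul_L A.1 _ _ _ hx, hφ.act_average τ A hx]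
  refine ⟨h, hh, fun τ => ⟨?_, (hh.contDiffOn τ).continuousOn, hact τ⟩⟩
  refine convexOn_of_hessian_nonneg_of_klein ((hh.contDiffOn τ).of_le (by norm_cast)) (hact τ) hΓr
    fun x hx w => ?_
  exact hessian_sub_const_mul_L_nonneg (hrB hx)
    (havg.contDiffAt Metric.isOpen_ball 2 τ (hrB hx)) (hc0 τ) (hbound τ x hx w)

end Main

end CoMinkowski

open CoMinkowski in
theorem mainTheorem8_general {d : ℕ} (Γ : Subgroup (OPlus d))
    [ProperlyDiscontinuousSMul Γ (hyperboloid d)]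
    [CompactSpace (MulAction.orbitRel.Quotient Γ (hyperboloid d))] :
    (∃ h : Z1 Γ → E d → ℝ, SmoothFamilyOn h (B d) ∧
      ∀ τ, ConvexOn ℝ (B d) (h τ) ∧ IsEquivariant τ (h τ)) ∧
    (∃ h : Z1 Γ → E d → ℝ, SmoothFamilyOn h (B d) ∧
      ∀ τ, ConcaveOn ℝ (B d) (h τ) ∧ IsEquivariant τ (h τ)) := by
  obtain ⟨h, hs, hh⟩ := exists_smoothFamilyOn_convexOn_isEquivariant Γ
  exact ⟨⟨h, hs, hh⟩, fun τ x => -h (-τ) x,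
    (hs.comp_continuous continuous_neg).neg Metric.isOpen_ball,
    fun τ => ⟨(hh (-τ)).1.neg, (hh (-τ)).2.neg⟩⟩

theorem mainTheorem8 (d : ℕ) (Γ : Subgroup (CoMinkowski.OPlus d))
    (hΓ : CoMinkowski.IsCompactHyperbolicManifold Γ) :
    (∃ h : CoMinkowski.Z1 Γ → CoMinkowski.E d → ℝ,
      (∀ τ : CoMinkowski.Z1 Γ,
        ContDiffOn ℝ ∞ (h τ) (CoMinkowski.B d) ∧ ConvexOn ℝ (CoMinkowski.B d) (h τ) ∧
          CoMinkowski.IsEquivariant τ (h τ)) ∧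
      ∀ (τ : CoMinkowski.Z1 Γ) (τs : ℕ → CoMinkowski.Z1 Γ), Tendsto τs atTop (𝓝 τ) →
        CoMinkowski.ConvergesWithSecondDerivs (fun n => h (τs n)) (h τ)) ∧
    (∃ h : CoMinkowski.Z1 Γ → CoMinkowski.E d → ℝ,
      (∀ τ : CoMinkowski.Z1 Γ,
        ContDiffOn ℝ ∞ (h τ) (CoMinkowski.B d) ∧ ConcaveOn ℝ (CoMinkowski.B d) (h τ) ∧
          CoMinkowski.IsEquivariant τ (h τ)) ∧
      ∀ (τ : CoMinkowski.Z1 Γ) (τs : ℕ → CoMinkowski.Z1 Γ), Tendsto τs atTop (𝓝 τ) →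
        CoMinkowski.ConvergesWithSecondDerivs (fun n => h (τs n)) (h τ)) := by
  have := hΓ.properlyDiscontinuous
  have := hΓ.compact_quotient
  obtain ⟨⟨h, hs, hh⟩, k, ks, hk⟩ := mainTheorem8_general Γ
  exact ⟨⟨h, fun τ => ⟨hs.contDiffOn τ, hh τ⟩, fun _ _ => hs.convergesWithSecondDerivs⟩,
    k, fun τ => ⟨ks.contDiffOn τ, hk τ⟩, fun _ _ => ks.convergesWithSecondDerivs⟩
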